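/- Let $T=(V,E)$ be a tree on $d$ vertices. For a positive integer $n$ let $$\chi_T^{\mathbf 1}(q,n)=\sum_{c} q^{\sum_{v\in V}c(v)},$$ where the sum is over all proper colorings $c:V\to\{1,\dots,n\}$ of $T$, and write $[n]_q=\frac{1-q^n}{1-q}$ and $[n]_q!=[1]_q[2]_q\cdots[n]_q$. There is a unique polynomial $\widetilde\chi_T^{\mathbf 1}(q,x)\in\mathbb Q(q)[x]$ such that $\widetilde\chi_T^{\mathbf 1}(q,[n]_q)=\chi_T^{\mathbf 1}(q,n)$ for all positive integers $n$, and its leading coefficient $c_T^{\mathbf 1}(q)$ (as a polynomial in $x$) satisfies $$c_T^{\mathbf 1}(q)=(q-q^2)^d\sum_{S\subseteq E}\ \prod_{C\in P(S)}\frac{1}{1-q^{|C|}}=\frac1{[d]_q!}\sum_{(\rho,\sigma)}q^{d+\operatorname{maj}\sigma}.$$ Here $P(S)$ is the collection of vertex sets of the connected components of the graph $(V,S)$ (isolated vertices included). The last sum is over all pairs of an acyclic orientation $\rho$ of $T$ and a linear extension $\sigma$ of the poset $\Pi_\rho$ induced by $\rho$ (where $v\preceq w$ if there is a directed path from $v$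 to $w$). For each $\rho$ an arbitrary natural labeling $\omega_\rho$ of $\Pi_\rho$ is fixed, that is, an order-preserving bijection $\omega_\rho:V\to\{1,\dots,d\}$; the linear extension, listing $V$ as $v_1,\dots,v_d$, is regarded as the permutation $\sigma(j)=\omega_\rho(v_j)$, and $\operatorname{maj}\sigma$ is the sum of all $j\in\{1,\dots,d-1\}$ with $\sigma(j+1)<\sigma(j)$. -/

import Mathlib

namespace QChromatic

open Polynomial

/-- The field `ℚ(q)` of rational functions in one indeterminate. -/
abbrev Qq : Type := RatFunc ℚ

/-- The indeterminate `q` of `ℚ(q)`. -/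
noncomputable abbrev q : Qq := RatFunc.X

/-- The `q`-integer `[n]_q = (1 - q^n) / (1 - q)`. -/
noncomputable def qInt (n : ℕ) : Qq := (1 - q ^ n) / (1 - q)

/-- The `q`-factorial `[n]_q! = [1]_q [2]_q ⋯ [n]_q`. -/
noncomputable def qFact (n : ℕ) : Qq := ∏ i ∈ Finset.Icc 1 n, qInt i

section Graph

variable {V : Type*}

open Classical in
/-- The finite set of proper colorings `c : V → {1, …, n}` of `G`. -/
noncomputable def properColorings [Fintype V] (G : SimpleGraph V) (n : ℕ) : Finset (V → ℕ) :=
  (Fintype.piFinset fun _ : V => Finset.Icc 1 n).filter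
    fun c => ∀ v w, G.Adj v w → c v ≠ c w

/-- `χ_G^λ(q, n) = ∑ q^{∑_v λ_v c(v)}`, the sum over proper colorings `c : V → {1, …, n}`. -/
noncomputable def qChromaticCount [Fintype V] (G : SimpleGraph V) (lam : V → ℕ) (n : ℕ) : Qq :=
  ∑ c ∈ properColorings G n, q ^ (∑ v, lam v * c v)

/-- `p ∈ ℚ(q)[x]` is the `q`-chromatic polynomial of `G` with respect to `λ`:
`p([n]_q) = χ_G^λ(q, n)` for all positive integers `n`. -/
def IsQChromaticPolynomial [Fintype V] (G : SimpleGraph V) (lam : V → ℕ) (p : Qq[X]) : Prop :=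
  ∀ n : ℕ, 0 < n → p.eval (qInt n) = qChromaticCount G lam n

open Classical in
/-- `P(S)`: the collection of vertex sets of the connected components of the
spanning subgraph `(V, S)`. -/
noncomputable def componentSets [Fintype V] (S : Finset (Sym2 V)) : Finset (Finset V) :=
  Finset.univ.filter fun C : Finset V =>
    ∃ K : (SimpleGraph.fromEdgeSet (S : Set (Sym2 V))).ConnectedComponent, (C : Set V) = K.supp

/-- An acyclic orientation of `G`: every edge gets exactly one of its two directions
(`rel v w` means that the edge `vw` is directed from `v` to `w`), with no directed cycle. -/
@[ext]
structure AcyclicOrientation (G : SimpleGraph V) where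
  rel : V → V → Prop
  adj_of_rel : ∀ v w, rel v w → G.Adj v w
  rel_or_rel : ∀ v w, G.Adj v w → rel v w ∨ rel w v
  not_rel_and_rel : ∀ v w, ¬ (rel v w ∧ rel w v)
  acyclic : ∀ v, ¬ Relation.TransGen rel v v

noncomputable instance [Finite V] (G : SimpleGraph V) : Fintype (AcyclicOrientation G) :=
  haveI : Finite (AcyclicOrientation G) :=
    Finite.of_injective AcyclicOrientation.rel fun _ _ h => AcyclicOrientation.ext h
  Fintype.ofFinite _

/-- The order of the poset `Π_ρ` induced by `ρ`: `v ≤ w` when there is a directed path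
(possibly of length `0`) from `v` to `w`. -/
@[reducible]
def AcyclicOrientation.poset {G : SimpleGraph V} (ρ : AcyclicOrientation G) : PartialOrder V where
  le := Relation.ReflTransGen ρ.rel
  le_refl _ := Relation.ReflTransGen.refl
  le_trans _ _ _ := Relation.ReflTransGen.trans
  le_antisymm v w hvw hwv := by
    rcases Relation.reflTransGen_iff_eq_or_transGen.1 hvw with h | h
    · exact h.symm
    · exact absurd (h.trans_left hwv) (ρ.acyclic v)

/-- The order-preserving bijections from a poset `P` on `V` to `{1, …, d}`
(represented as `Fin d`). These are both the linear extensions and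
the natural labelings of `P`. -/
def LinExt (P : PartialOrder V) (d : ℕ) : Type _ :=
  {e : V ≃ Fin d // ∀ v w, P.le v w → e v ≤ e w}

noncomputable instance [Finite V] (P : PartialOrder V) (d : ℕ) :
    Fintype (LinExt P d) :=
  haveI : Finite (LinExt P d) := inferInstanceAs (Finite (Subtype _))
  Fintype.ofFinite _

/-- Every finite poset has a linear extension, equivalently a natural labeling. -/
theorem LinExt.nonempty [Fintype V] (P : PartialOrder V) {d : ℕ}
    (hd : Fintype.card V = d) : Nonempty (LinExt P d) := by
  classical
  let _ := P
  let _ : Fintype (LinearExtension V) := inferInstanceAs (Fintype V)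
  have hc : Fintype.card (LinearExtension V) = d := hd
  let f : V ≃ Fin d := (Fintype.orderIsoFinOfCardEq (LinearExtension V) hc).symm.toEquiv
  refine ⟨⟨f, fun v w h => ?_⟩⟩
  exact (Fintype.orderIsoFinOfCardEq (LinearExtension V) hc).symm.monotone
    (toLinearExtension.monotone h)

/-- The linear extension `e` as a permutation of `{1, …, d}`, written in terms of the natural
labeling `ω`: its `j`-th letter is the label of the `j`-th element in the linear extension. -/
def LinExt.perm {P : PartialOrder V} {d : ℕ} (ω e : LinExt P d) :
    Equiv.Perm (Fin d) :=
  e.1.symm.trans ω.1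

end Graph

/-- The major index of a permutation `σ` of `{1, …, d}`: the sum of the descents of `σ`,
the positions `j` with `1 ≤ j < d` and `σ(j+1) < σ(j)`.
Position `j` is the element `j - 1` of `Fin d`. -/
def maj {d : ℕ} (σ : Equiv.Perm (Fin d)) : ℕ :=
  ∑ i : Fin d, if h : i.val + 1 < d then (if σ ⟨i.val + 1, h⟩ < σ i then i.val + 1 else 0) else 0

end QChromatic

namespace QChromatic

open Polynomial
open scoped ENNReal nonZeroDivisors

/-! Inclusion-exclusion over the monochromatic edges writes the coloring sum as an alternating sum
over S ⊆ E of products, over the components A of (V, S), of the power sums ∑ q^(|A| k), k ≤ n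
(`qChromaticCount_eq`). Since q^n = 1 - (1 - q)[n]_q, each power sum is a polynomial in [n]_q of
degree |A|, so every S contributes degree d. In a tree |S| plus the number of components is d, so
all signs cancel in the top coefficient (`coeff_qChromaticPoly`), which gives the first formula.
Uniqueness holds because the [n]_q are pairwise distinct.

For the second formula, q is specialised to a transcendental t in (0, 1) and both sides count, with
weight t^(∑ f), the pairs of an acyclic orientation and a function f : V → ℕ weakly decreasing along
it. For fixed f, an edge with distinct values has a forced direction and an edge with equal values
has two, so such orientations are as many as the sets S of edges on which f is constant
(`card_orientations`). Summing over f first gives the component products (`tsum_const_on_edges`).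
Fixing the orientation instead, Stanley's theory of P-partitions sorts each f along a unique linear
extension, with strict drops at its descents, which produces the major index
(`tsum_orderReversing`). -/

/-! ### Multiple geometric series and a real specialisation of q -/

theorem tsum_fin_prod (n : ℕ) (F : Fin n → ℕ → ℝ≥0∞) :
    ∑' a : Fin n → ℕ, ∏ i, F i (a i) = ∏ i, ∑' k, F i k := by
  induction n with
  | zero => simp [tsum_fintype]
  | succ n ih =>
    rw [← (Fin.consEquiv fun _ => ℕ).tsum_eq, ENNReal.tsum_prod', Fin.prod_univ_succ, ← ih,
      ← ENNReal.tsum_mul_right]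
    refine tsum_congr fun k => ?_
    rw [← ENNReal.tsum_mul_left]
    refine tsum_congr fun a => ?_
    simp [Fin.consEquiv, Fin.prod_univ_succ]

/-- A sum of products over functions on a finite type is a product of sums. -/
theorem tsum_pi_prod {ι : Type*} [Fintype ι] (F : ι → ℕ → ℝ≥0∞) :
    ∑' a : ι → ℕ, ∏ i, F i (a i) = ∏ i, ∑' k, F i k := by
  classical
  let e := Fintype.equivFin ι
  rw [← (Equiv.arrowCongr e.symm (Equiv.refl ℕ)).tsum_eq, ← e.symm.prod_comp, ← tsum_fin_prod]
  refine tsum_congr fun a => ?_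
  rw [← e.symm.prod_comp]
  simp [Equiv.arrowCongr]

/-- No convergence condition is needed: in `ℝ≥0∞` a divergent geometric series is `⊤`, and truncated
subtraction makes the right side `0⁻¹ = ⊤` as well. -/
theorem tsum_pi_pow {ι : Type*} [Fintype ι] (t : ℝ≥0∞) (m : ι → ℕ) :
    ∑' a : ι → ℕ, t ^ (∑ i, m i * a i) = ∏ i, (1 - t ^ m i)⁻¹ := by
  simp_rw [← Finset.prod_pow_eq_pow_sum, pow_mul]
  rw [tsum_pi_prod fun i k => (t ^ m i) ^ k]
  simp [ENNReal.tsum_geometric]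

/-- `ℚ(q)` embeds in `ℝ` with `q` going to a (transcendental) number in `(0, 1)`. -/
theorem exists_ringHom_real : ∃ φ : Qq →+* ℝ, 0 < φ q ∧ φ q < 1 := by
  -- The interval is uncountable, the algebraic numbers are countable.
  obtain ⟨t, ht, ht'⟩ : ∃ t ∈ Set.Ioo (0 : ℝ) 1, t ∉ {x : ℝ | IsAlgebraic ℚ x} := by
    by_contra! h
    exact (Cardinal.Real.Ioo_countable_iff.not.2 (by norm_num))
      ((Algebraic.countable ℚ ℝ).mono fun x hx => h x hx)
  have hinj : Function.Injective (aeval (R := ℚ) t).toRingHom :=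
    transcendental_iff_injective.1 ht'
  have hle : ℚ[X]⁰ ≤ (ℝ⁰).comap (aeval (R := ℚ) t).toRingHom :=
    nonZeroDivisors_le_comap_nonZeroDivisors_of_injective _ hinj
  refine ⟨RatFunc.liftRingHom _ hle, ?_⟩
  have : RatFunc.liftRingHom _ hle q = t := by
    rw [q, RatFunc.liftRingHom_X]; simp
  rw [this]
  exact ht

/-! ### Connected components of spanning subgraphs -/

section Components

variable {V : Type*} [Fintype V]

/-- Functions that are constant along the edges of `G` are functions on the connected components. -/
def constEquiv (G : SimpleGraph V) :
    (G.ConnectedComponent → ℕ) ≃ {c : V → ℕ // ∀ v w, G.Adj v w → c v = c w} where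
  toFun g := ⟨fun v => g (G.connectedComponentMk v), fun v w h => by
    exact congrArg g (SimpleGraph.ConnectedComponent.sound h.reachable)⟩
  invFun c := fun K => K.lift c.1 fun v w p _ => by
    induction p with
    | nil => rfl
    | cons h p ih => rename_i hp; rw [c.2 _ _ h, ih hp.of_cons]
  left_inv g := by
    ext K
    induction K using SimpleGraph.ConnectedComponent.ind
    rfl
  right_inv c := rfl

open Classical in
/-- The number of vertices of a connected component. -/
noncomputable def compSize {G : SimpleGraph V} (K : G.ConnectedComponent) : ℕ :=
  (Finset.univ.filter fun v => G.connectedComponentMk v = K).card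

theorem sum_connectedComponentMk {G : SimpleGraph V} [Fintype G.ConnectedComponent]
    (g : G.ConnectedComponent → ℕ) :
    ∑ v, g (G.connectedComponentMk v) = ∑ K, compSize K * g K := by
  classical
  rw [← Finset.sum_fiberwise Finset.univ G.connectedComponentMk]
  refine Finset.sum_congr rfl fun K _ => ?_
  rw [Finset.sum_congr rfl (g := fun _ => g K) fun v hv => by rw [(Finset.mem_filter.1 hv).2]]
  simp [compSize]

theorem sum_compSize (G : SimpleGraph V) [Fintype G.ConnectedComponent] :
    ∑ K : G.ConnectedComponent, compSize K = Fintype.card V := by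
  simpa using (sum_connectedComponentMk (G := G) fun _ => 1).symm

/-- Translates between components as vertex sets, used in the final formula, and components as a
type, over which functions constant on edges are parametrized. -/
theorem prod_componentSets {M : Type*} [CommMonoid M] (S : Finset (Sym2 V))
    [Fintype (SimpleGraph.fromEdgeSet (S : Set (Sym2 V))).ConnectedComponent] (F : ℕ → M) :
    ∏ C ∈ componentSets S, F C.card =
      ∏ K : (SimpleGraph.fromEdgeSet (S : Set (Sym2 V))).ConnectedComponent, F (compSize K) := by
  classical
  symm
  refine Finset.prod_bij (fun K _ => Finset.univ.filter fun v =>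
    SimpleGraph.connectedComponentMk _ v = K) ?_ ?_ ?_ ?_
  · intro K _
    simp only [componentSets, Finset.mem_filter, Finset.mem_univ, true_and]
    exact ⟨K, by ext v; simp⟩
  · intro K _ K' _ h
    apply SimpleGraph.ConnectedComponent.supp_injective
    ext v
    simpa using Finset.ext_iff.1 h v
  · intro C hC
    simp only [componentSets, Finset.mem_filter, Finset.mem_univ, true_and] at hC
    obtain ⟨K, hK⟩ := hC
    refine ⟨K, Finset.mem_univ _, ?_⟩
    apply Finset.coe_injective
    rw [hK]
    ext v
    simp
  · intro K _
    rfl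

omit [Fintype V] in
theorem reachable_or_of_reachable_insert {S : Set (Sym2 V)} {u v x y : V}
    (h : (SimpleGraph.fromEdgeSet (insert s(u, v) S)).Reachable x y) :
    (SimpleGraph.fromEdgeSet S).Reachable x y ∨
      (SimpleGraph.fromEdgeSet S).Reachable x v ∨ (SimpleGraph.fromEdgeSet S).Reachable y v := by
  -- The stronger claim records which endpoint of the new edge each of x and y reaches, so that it
  -- passes through the induction on the walk.
  suffices H : (SimpleGraph.fromEdgeSet S).Reachable x y ∨
      ((SimpleGraph.fromEdgeSet S).Reachable x u ∧ (SimpleGraph.fromEdgeSet S).Reachable y v) ∨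
      ((SimpleGraph.fromEdgeSet S).Reachable x v ∧ (SimpleGraph.fromEdgeSet S).Reachable y u) by
    tauto
  obtain ⟨p⟩ := h
  induction p with
  | nil => exact Or.inl .rfl
  | @cons a b c hab p ih =>
    rw [SimpleGraph.fromEdgeSet_adj, Set.mem_insert_iff, Sym2.eq_iff] at hab
    have hr : ∀ w, (SimpleGraph.fromEdgeSet S).Reachable w w := fun _ => .rfl
    obtain ⟨(⟨rfl, rfl⟩ | ⟨rfl, rfl⟩) | hab, hne⟩ := hab
    · grind [SimpleGraph.Reachable.trans, SimpleGraph.Reachable.symm]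
    · grind [SimpleGraph.Reachable.trans, SimpleGraph.Reachable.symm]
    · have : (SimpleGraph.fromEdgeSet S).Reachable a b :=
        SimpleGraph.Adj.reachable (by simp [hab, hne])
      grind [SimpleGraph.Reachable.trans]

/-- Adding an edge lowers the number of components by at most one. -/
theorem card_component_le_insert (S : Finset (Sym2 V)) (e : Sym2 V) [DecidableEq V] :
    Nat.card (SimpleGraph.fromEdgeSet (S : Set (Sym2 V))).ConnectedComponent ≤
      Nat.card (SimpleGraph.fromEdgeSet ((insert e S : Finset _) : Set (Sym2 V))).ConnectedComponent
        + 1 := by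
  classical
  induction e using Sym2.ind with | _ u v
  set G := SimpleGraph.fromEdgeSet (S : Set (Sym2 V))
  set G' := SimpleGraph.fromEdgeSet ((insert s(u, v) S : Finset _) : Set (Sym2 V)) with hG'
  have hle : G ≤ G' := SimpleGraph.fromEdgeSet_mono (by simp)
  -- Only the component of v can merge with another one: once it is removed, the remaining
  -- components map injectively to those of the larger graph.
  rw [Nat.card_eq_fintype_card, Nat.card_eq_fintype_card, ← Finset.card_univ,
    ← Finset.card_erase_add_one (Finset.mem_univ (G.connectedComponentMk v)), ← Finset.card_univ]
  refine Nat.add_le_add_right (Finset.card_le_card_of_injOn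
    (fun K => K.map (SimpleGraph.Hom.ofLE hle)) (fun _ _ => Finset.mem_coe.2 (Finset.mem_univ _)) ?_) 1
  intro K hK L hL h
  induction K using SimpleGraph.ConnectedComponent.ind with | _ x
  induction L using SimpleGraph.ConnectedComponent.ind with | _ y
  simp only [Finset.coe_erase, Finset.coe_univ, Set.mem_sdiff, Set.mem_univ, true_and,
    Set.mem_singleton_iff, SimpleGraph.ConnectedComponent.eq] at hK hL
  rw [SimpleGraph.ConnectedComponent.eq]
  have h' : G'.Reachable x y := SimpleGraph.ConnectedComponent.exact h
  rw [hG', Finset.coe_insert] at h'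
  rcases reachable_or_of_reachable_insert h' with h | h | h
  · exact h
  · exact absurd h hK
  · exact absurd h hL

theorem card_component_le_union (S U : Finset (Sym2 V)) [DecidableEq V] :
    Nat.card (SimpleGraph.fromEdgeSet (S : Set (Sym2 V))).ConnectedComponent ≤
      Nat.card (SimpleGraph.fromEdgeSet ((U ∪ S : Finset _) : Set (Sym2 V))).ConnectedComponent
        + U.card := by
  induction U using Finset.induction_on with
  | empty => simp
  | insert e U he ih =>
    rw [Finset.insert_union, Finset.card_insert_of_notMem he]
    have := card_component_le_insert (U ∪ S) e
    omega

/-- A spanning forest of a tree: edges plus components equals vertices. -/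
theorem card_add_card_component [DecidableEq V] {T : SimpleGraph V} [DecidableRel T.Adj]
    (hT : T.IsTree) {S : Finset (Sym2 V)} (hS : S ⊆ T.edgeFinset) :
    S.card + Nat.card (SimpleGraph.fromEdgeSet (S : Set (Sym2 V))).ConnectedComponent =
      Fintype.card V := by
  -- Building S up from no edges gives one inequality, completing S to the whole tree gives the
  -- other.
  have h1 := card_component_le_union (V := V) ∅ S
  have h2 := card_component_le_union S (T.edgeFinset \ S)
  have h0 : Nat.card (SimpleGraph.fromEdgeSet ((∅ : Finset (Sym2 V)) : Set (Sym2 V))).ConnectedComponent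
      = Fintype.card V := by
    rw [← Nat.card_eq_fintype_card]
    refine (Nat.card_eq_of_bijective (SimpleGraph.connectedComponentMk _) ⟨?_, ?_⟩).symm
    · intro x y h
      simpa using SimpleGraph.ConnectedComponent.exact h
    · exact fun K => K.exists_rep
  have h3 : Nat.card (SimpleGraph.fromEdgeSet (T.edgeFinset : Set (Sym2 V))).ConnectedComponent = 1 := by
    rw [SimpleGraph.coe_edgeFinset, SimpleGraph.fromEdgeSet_edgeSet, Nat.card_eq_one_iff_unique]
    have := hT.connected.nonempty
    exact ⟨hT.connected.preconnected.subsingleton_connectedComponent, inferInstance⟩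
  rw [Finset.sdiff_union_of_subset hS, h3, Finset.card_sdiff_of_subset hS] at h2
  have h4 := hT.card_edgeFinset
  have h5 := Finset.card_le_card hS
  rw [h0, Finset.union_empty] at h1
  omega

end Components

/-! ### q-integers and power sums as polynomials in them -/

open Polynomial

theorem one_sub_q_pow_ne_zero {m : ℕ} (hm : 0 < m) : 1 - q ^ m ≠ 0 := by
  obtain ⟨φ, h0, h1⟩ := exists_ringHom_real
  intro h
  have := congrArg φ h
  simp only [map_sub, map_one, map_pow, map_zero] at this
  have := pow_lt_one₀ h0.le h1 hm.ne'
  linarith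

theorem one_sub_q_ne_zero : 1 - q ≠ 0 := by
  simpa using one_sub_q_pow_ne_zero one_pos

theorem q_ne_zero : q ≠ 0 := RatFunc.X_ne_zero

theorem qInt_injective : Function.Injective qInt := by
  obtain ⟨φ, h0, h1⟩ := exists_ringHom_real
  intro m n h
  rw [qInt, qInt, div_left_inj' one_sub_q_ne_zero, sub_right_inj] at h
  have h' := congrArg φ h
  simp only [map_pow] at h'
  exact pow_right_injective₀ h0 h1.ne h'

theorem one_sub_mul_qInt (n : ℕ) : 1 - (1 - q) * qInt n = q ^ n := by
  rw [qInt, mul_div_cancel₀ _ one_sub_q_ne_zero, sub_sub_cancel]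

theorem eq_of_eval_qInt {p p' : Qq[X]} (h : ∀ n, 0 < n → p.eval (qInt n) = p'.eval (qInt n)) :
    p = p' := by
  refine Polynomial.eq_of_infinite_eval_eq p p' (Set.Infinite.mono ?_
    ((Set.Ioi_infinite 0).image qInt_injective.injOn))
  rintro _ ⟨n, hn, rfl⟩
  exact h n hn

/-- The polynomial whose value at `[n]_q` is `∑ k ∈ {1, …, n}, q ^ (m * k)`. -/
noncomputable def powerSumPoly (m : ℕ) : Qq[X] :=
  C (q ^ m / (1 - q ^ m)) * (1 - (1 - C (1 - q) * X) ^ m)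

theorem eval_powerSumPoly {m : ℕ} (hm : 0 < m) (n : ℕ) :
    (powerSumPoly m).eval (qInt n) = ∑ k ∈ Finset.Icc 1 n, q ^ (m * k) := by
  have h : (powerSumPoly m).eval (qInt n) = q ^ m / (1 - q ^ m) * (1 - (q ^ n) ^ m) := by
    simp only [powerSumPoly, eval_mul, eval_C, eval_sub, eval_one, eval_pow, eval_X,
      one_sub_mul_qInt]
  have hm' := one_sub_q_pow_ne_zero hm
  rw [h]
  induction n with
  | zero => simp
  | succ n ih =>
    rw [Finset.sum_Icc_succ_top (by omega), ← ih (by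
      simp only [powerSumPoly, eval_mul, eval_C, eval_sub, eval_one, eval_pow, eval_X,
        one_sub_mul_qInt])]
    field_simp
    ring

/-- The top term comes from -(1 - (1 - q)x)^m. The sign is kept apart from the factor (q - q^2)^m so
that the signs can be collected over all components. -/
theorem natDegree_leadingCoeff_powerSumPoly {m : ℕ} (hm : 0 < m) :
    (powerSumPoly m).natDegree = m ∧
      (powerSumPoly m).leadingCoeff = (-1) ^ (m + 1) * ((q - q ^ 2) ^ m * (1 / (1 - q ^ m))) := by
  have hq := one_sub_q_ne_zero
  have hlin : (1 - C (1 - q) * X : Qq[X]) = C (-(1 - q)) * X + C 1 := by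
    simp only [C_neg, C_1]; ring
  have hd1 : (1 - C (1 - q) * X : Qq[X]).natDegree = 1 := by
    rw [hlin]; exact natDegree_linear (neg_ne_zero.2 hq)
  have hl1 : (1 - C (1 - q) * X : Qq[X]).leadingCoeff = -(1 - q) := by
    rw [hlin]; exact leadingCoeff_linear (neg_ne_zero.2 hq)
  have hdm : ((1 - C (1 - q) * X : Qq[X]) ^ m).natDegree = m := by
    rw [natDegree_pow, hd1, mul_one]
  have hd2 : (1 - (1 - C (1 - q) * X : Qq[X]) ^ m).natDegree = m := by
    rw [natDegree_sub_eq_right_of_natDegree_lt (by rw [natDegree_one, hdm]; exact hm), hdm]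
  have hl2 : (1 - (1 - C (1 - q) * X : Qq[X]) ^ m).leadingCoeff = -(-(1 - q)) ^ m := by
    rw [leadingCoeff, hd2, coeff_sub, coeff_one, if_neg hm.ne', ← hl1, ← leadingCoeff_pow,
      leadingCoeff, hdm, zero_sub]
  have hc : q ^ m / (1 - q ^ m) ≠ 0 :=
    div_ne_zero (pow_ne_zero _ q_ne_zero) (one_sub_q_pow_ne_zero hm)
  refine ⟨by rw [powerSumPoly, natDegree_C_mul hc, hd2], ?_⟩
  rw [powerSumPoly, leadingCoeff_mul, leadingCoeff_C, hl2, neg_pow (1 - q),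
    show q - q ^ 2 = q * (1 - q) by ring, mul_pow]
  ring

/-! ### Inclusion-exclusion and the leading coefficient -/

section

variable {V : Type*} [Fintype V]

theorem componentSets_card_pos {S : Finset (Sym2 V)} {A : Finset V} (hA : A ∈ componentSets S) :
    0 < A.card := by
  simp only [componentSets, Finset.mem_filter, Finset.mem_univ, true_and] at hA
  obtain ⟨K, hK⟩ := hA
  obtain ⟨v, hv⟩ := K.nonempty_supp
  exact Finset.card_pos.2 ⟨v, by rw [← Finset.mem_coe, hK]; exact hv⟩

theorem sum_componentSets_card (S : Finset (Sym2 V)) :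
    ∑ A ∈ componentSets S, A.card = Fintype.card V := by
  classical
  -- Read in `Multiplicative ℕ`, the product formula becomes a formula for sums.
  have := prod_componentSets (M := Multiplicative ℕ) S Multiplicative.ofAdd
  rw [← ofAdd_sum, ← ofAdd_sum, sum_compSize] at this
  exact this

theorem card_componentSets (S : Finset (Sym2 V)) :
    (componentSets S).card =
      Nat.card (SimpleGraph.fromEdgeSet (S : Set (Sym2 V))).ConnectedComponent := by
  classical
  have := prod_componentSets (M := Multiplicative ℕ) S fun _ => Multiplicative.ofAdd 1
  rw [← ofAdd_sum, ← ofAdd_sum] at this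
  simpa using this

open Classical in
theorem sum_const_on_edges (S : Finset (Sym2 V)) (n : ℕ) :
    ∑ c ∈ (Fintype.piFinset fun _ : V => Finset.Icc 1 n) with
        ∀ v w, (SimpleGraph.fromEdgeSet (S : Set (Sym2 V))).Adj v w → c v = c w,
        q ^ (∑ v, c v) =
      ∏ A ∈ componentSets S, ∑ k ∈ Finset.Icc 1 n, q ^ (A.card * k) := by
  rw [prod_componentSets S fun m => ∑ k ∈ Finset.Icc 1 n, q ^ (m * k), Finset.prod_univ_sum]
  symm
  refine Finset.sum_bij (fun g _ => (constEquiv _ g).1) ?_ ?_ ?_ ?_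
  · intro g hg
    rw [Finset.mem_filter]
    refine ⟨Fintype.mem_piFinset.2 fun v => Fintype.mem_piFinset.1 hg _, (constEquiv _ g).2⟩
  · intro g _ g' _ h
    exact (constEquiv _).injective (Subtype.ext h)
  · intro c hc
    rw [Finset.mem_filter] at hc
    refine ⟨(constEquiv _).symm ⟨c, hc.2⟩, Fintype.mem_piFinset.2 fun K => ?_, by simp⟩
    induction K using SimpleGraph.ConnectedComponent.ind with | _ v
    exact Fintype.mem_piFinset.1 hc.1 v
  · intro g _
    rw [Finset.prod_pow_eq_pow_sum, ← sum_connectedComponentMk]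
    rfl

omit [Fintype V] in
theorem const_on_fromEdgeSet_iff (S : Finset (Sym2 V)) (c : V → ℕ) :
    (∀ v w, (SimpleGraph.fromEdgeSet (S : Set (Sym2 V))).Adj v w → c v = c w) ↔
      ∀ e ∈ S, (e.map c).IsDiag := by
  constructor
  · intro h e he
    induction e using Sym2.ind with | _ v w
    rw [Sym2.map_mk, Sym2.mk_isDiag_iff]
    by_cases hvw : v = w
    · rw [hvw]
    · exact h v w ((SimpleGraph.fromEdgeSet_adj _).2 ⟨he, hvw⟩)
  · intro h v w hvw
    simpa using h _ ((SimpleGraph.fromEdgeSet_adj _).1 hvw).1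

/-- The indicator of a proper coloring is the product over edges of 1 minus the indicator that the
edge is monochromatic. Expanding it and exchanging sums leaves, for each S, the colorings constant
on the components of (V, S). -/
theorem qChromaticCount_eq [DecidableEq V] (G : SimpleGraph V) [DecidableRel G.Adj] (n : ℕ) :
    qChromaticCount G (fun _ => 1) n =
      ∑ S ∈ G.edgeFinset.powerset, (-1) ^ S.card *
        ∏ A ∈ componentSets S, ∑ k ∈ Finset.Icc 1 n, q ^ (A.card * k) := by
  classical
  simp_rw [← sum_const_on_edges, Finset.sum_filter, Finset.mul_sum]
  rw [Finset.sum_comm, qChromaticCount, properColorings, Finset.sum_filter]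
  refine Finset.sum_congr (by congr) fun c _ => ?_
  have h1 := Finset.prod_sub (fun _ : Sym2 V => (1 : Qq))
    (fun e => if (e.map c).IsDiag then 1 else 0) G.edgeFinset
  simp only [Finset.prod_const_one, mul_one, Finset.prod_ite_zero] at h1
  have h2 : (∏ e ∈ G.edgeFinset, ((1 : Qq) - if (e.map c).IsDiag then 1 else 0)) =
      if ∀ v w, G.Adj v w → c v ≠ c w then 1 else 0 := by
    split_ifs with h
    · refine Finset.prod_eq_one fun e he => ?_
      induction e using Sym2.ind with | _ v w
      rw [SimpleGraph.mem_edgeFinset, SimpleGraph.mem_edgeSet] at he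
      simp [h v w he]
    · push Not at h
      obtain ⟨v, w, hvw, hc⟩ := h
      exact Finset.prod_eq_zero (i := s(v, w)) (by simpa using hvw) (by simp [hc])
  simp only [const_on_fromEdgeSet_iff, one_mul]
  calc _ = (if ∀ v w, G.Adj v w → c v ≠ c w then (1 : Qq) else 0) * q ^ (∑ v, c v) := by
        rw [ite_mul, one_mul, zero_mul]
    _ = _ := by
        rw [← h2, h1, Finset.sum_mul]
        refine Finset.sum_congr rfl fun S _ => ?_
        split_ifs <;> simp

/-- The `q`-chromatic polynomial of `G`. -/
noncomputable def qChromaticPoly [DecidableEq V] (G : SimpleGraph V) [DecidableRel G.Adj] :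
    Qq[X] :=
  ∑ S ∈ G.edgeFinset.powerset, (-1) ^ S.card * ∏ A ∈ componentSets S, powerSumPoly A.card

theorem isQChromaticPolynomial_iff [DecidableEq V] (G : SimpleGraph V) [DecidableRel G.Adj]
    (p : Qq[X]) : IsQChromaticPolynomial G (fun _ => 1) p ↔ p = qChromaticPoly G := by
  have h : IsQChromaticPolynomial G (fun _ => 1) (qChromaticPoly G) := by
    intro n _
    rw [qChromaticCount_eq, qChromaticPoly, eval_finsetSum]
    refine Finset.sum_congr rfl fun S _ => ?_
    rw [eval_mul, eval_pow, eval_neg, eval_one, eval_prod]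
    congr 1
    exact Finset.prod_congr rfl fun A hA => eval_powerSumPoly (componentSets_card_pos hA) n
  exact ⟨fun hp => eq_of_eval_qInt fun n hn => (hp n hn).trans (h n hn).symm, fun hp => hp ▸ h⟩

/-- The sum over edge subsets giving the leading coefficient for a tree. -/
noncomputable def leadSum [DecidableEq V] (T : SimpleGraph V) [DecidableRel T.Adj] : Qq :=
  ∑ S ∈ T.edgeFinset.powerset, ∏ A ∈ componentSets S, 1 / (1 - q ^ A.card)

theorem natDegree_summand_le (S : Finset (Sym2 V)) :
    ((-1 : Qq[X]) ^ S.card * ∏ A ∈ componentSets S, powerSumPoly A.card).natDegree ≤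
      Fintype.card V := by
  refine natDegree_mul_le.trans ?_
  have h1 : ((-1 : Qq[X]) ^ S.card).natDegree = 0 := by simp [natDegree_pow]
  rw [h1, zero_add, ← sum_componentSets_card S]
  refine (natDegree_prod_le _ _).trans (Finset.sum_le_sum fun A hA => ?_)
  exact (natDegree_leadingCoeff_powerSumPoly (componentSets_card_pos hA)).1.le

theorem natDegree_prod_powerSumPoly (S : Finset (Sym2 V)) :
    (∏ A ∈ componentSets S, powerSumPoly A.card).natDegree = Fintype.card V := by
  rw [← sum_componentSets_card S, natDegree_prod]
  · exact Finset.sum_congr rfl fun A hA =>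
      (natDegree_leadingCoeff_powerSumPoly (componentSets_card_pos hA)).1
  · intro A hA h
    have h1 := (natDegree_leadingCoeff_powerSumPoly (componentSets_card_pos hA)).1
    have h2 := componentSets_card_pos hA
    rw [h, natDegree_zero] at h1
    omega

theorem coeff_qChromaticPoly [DecidableEq V] {T : SimpleGraph V} [DecidableRel T.Adj]
    (hT : T.IsTree) :
    (qChromaticPoly T).coeff (Fintype.card V) = (q - q ^ 2) ^ Fintype.card V * leadSum T := by
  rw [qChromaticPoly, finsetSum_coeff, leadSum, Finset.mul_sum]
  refine Finset.sum_congr rfl fun S hS => ?_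
  have hcard := card_add_card_component hT (Finset.mem_powerset.1 hS)
  rw [← card_componentSets] at hcard
  rw [show (-1 : Qq[X]) ^ S.card = C ((-1) ^ S.card) by simp, coeff_C_mul]
  nth_rw 1 [← natDegree_prod_powerSumPoly S]
  rw [coeff_natDegree, leadingCoeff_prod,
    Finset.prod_congr rfl fun A hA =>
      (natDegree_leadingCoeff_powerSumPoly (componentSets_card_pos hA)).2,
    Finset.prod_mul_distrib, Finset.prod_mul_distrib, Finset.prod_pow_eq_pow_sum,
    Finset.prod_pow_eq_pow_sum, Finset.sum_add_distrib, sum_componentSets_card, ← mul_assoc,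
    ← pow_add]
  -- The total sign exponent is 2d, because the edges and components of a spanning forest add up to
  -- d.
  have : Even (S.card + (Fintype.card V + ∑ A ∈ componentSets S, 1)) := by
    rw [← Finset.card_eq_sum_ones]
    exact ⟨Fintype.card V, by omega⟩
  rw [this.neg_one_pow, one_mul]

/-- Ensures that the coefficient of x^d does not vanish, hence that it is the leading one. -/
theorem leadSum_map_pos [DecidableEq V] {T : SimpleGraph V} [DecidableRel T.Adj]
    (φ : Qq →+* ℝ) (h0 : 0 < φ q) (h1 : φ q < 1) : 0 < φ (leadSum T) := by
  simp only [leadSum, map_sum, map_prod, map_div₀, map_one, map_sub, map_pow]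
  refine Finset.sum_pos (fun S _ => Finset.prod_pos fun A hA => ?_) ⟨∅, by simp⟩
  exact one_div_pos.2 (sub_pos.2 (pow_lt_one₀ h0.le h1 (componentSets_card_pos hA).ne'))

theorem leadingCoeff_qChromaticPoly [DecidableEq V] {T : SimpleGraph V} [DecidableRel T.Adj]
    (hT : T.IsTree) :
    (qChromaticPoly T).leadingCoeff = (q - q ^ 2) ^ Fintype.card V * leadSum T := by
  have hne : (qChromaticPoly T).coeff (Fintype.card V) ≠ 0 := by
    rw [coeff_qChromaticPoly hT]
    refine mul_ne_zero (pow_ne_zero _ ?_) fun h => ?_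
    · rw [show q - q ^ 2 = q * (1 - q) by ring]
      exact mul_ne_zero q_ne_zero one_sub_q_ne_zero
    · obtain ⟨φ, h0, h1⟩ := exists_ringHom_real
      have := leadSum_map_pos (T := T) φ h0 h1
      rw [h, map_zero] at this
      exact this.false
  have hle : (qChromaticPoly T).natDegree ≤ Fintype.card V :=
    natDegree_sum_le_of_forall_le _ _ fun S _ => natDegree_summand_le S
  rw [leadingCoeff, le_antisymm hle (le_natDegree_of_ne_zero hne), coeff_qChromaticPoly hT]

end

/-! ### Sequences with prescribed drops -/

open scoped ENNReal

section Sequences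

variable {d : ℕ}

/-- The entry of `g` following position `i`, and `0` after the last position. -/
def nextVal (g : Fin d → ℕ) (i : Fin d) : ℕ := if h : i.val + 1 < d then g ⟨i.val + 1, h⟩ else 0

theorem sum_Ici_eq (b : Fin d → ℕ) (i : Fin d) :
    ∑ j ∈ Finset.Ici i, b j = b i + nextVal (fun k => ∑ j ∈ Finset.Ici k, b j) i := by
  rw [← Finset.Ioi_insert, Finset.sum_insert (by simp), nextVal]
  congr 1
  split_ifs with h
  · refine Finset.sum_congr (Finset.ext fun j => ?_) fun _ _ => rfl
    simp only [Finset.mem_Ioi, Finset.mem_Ici, Fin.lt_def, Fin.le_def]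
    omega
  · refine Finset.sum_eq_zero fun j hj => ?_
    rw [Finset.mem_Ioi, Fin.lt_def] at hj
    omega

theorem eq_sum_Ici (g b : Fin d → ℕ) (h : ∀ i, g i = b i + nextVal g i) (i : Fin d) :
    g i = ∑ j ∈ Finset.Ici i, b j := by
  obtain ⟨i, hi⟩ := i
  -- The recursion runs backwards from the last position, where `nextVal` is 0.
  induction hk : d - i generalizing i with
  | zero => omega
  | succ k ih =>
    rw [h, sum_Ici_eq, nextVal, nextVal]
    congr 1
    split_ifs with h'
    · exact ih _ h' (by simp only; omega)
    · rfl

theorem sum_sum_Ici (b : Fin d → ℕ) :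
    ∑ i, ∑ j ∈ Finset.Ici i, b j = ∑ j : Fin d, (j.val + 1) * b j := by
  rw [Finset.sum_comm' (t' := Finset.univ) (s' := fun j => Finset.Iic j) (by simp)]
  simp

/-- Sequences with prescribed lower bounds `δ` on their successive drops
are parametrized by arbitrary sequences. -/
def dropEquiv (δ : Fin d → ℕ) :
    (Fin d → ℕ) ≃ {g : Fin d → ℕ // ∀ i, nextVal g i + δ i ≤ g i} where
  toFun a := ⟨fun i => ∑ j ∈ Finset.Ici i, (a j + δ j), fun i => by
    have := sum_Ici_eq (fun j => a j + δ j) i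
    dsimp only at this ⊢
    omega⟩
  invFun g i := g.1 i - nextVal g.1 i - δ i
  left_inv a := by
    ext i
    simp only
    rw [sum_Ici_eq]
    omega
  right_inv g := by
    ext i
    refine (eq_sum_Ici g.1 _ (fun i => ?_) i).symm
    have := g.2 i
    dsimp only
    omega

-- A sequence is the sum of its later drops, and the drop after position i (counted from 0) is
-- shared by i + 1 entries. The forced part δ of the drops gives the prefactor, the free part gives
-- the geometric series. For δ the descent indicator, the prefactor is t to the major index.
open Classical in
theorem tsum_drop (δ : Fin d → ℕ) (t : ℝ≥0∞) :
    ∑' g : Fin d → ℕ, (if ∀ i, nextVal g i + δ i ≤ g i then t ^ ∑ i, g i else 0) =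
      t ^ (∑ i : Fin d, (i.val + 1) * δ i) * ∏ i : Fin d, (1 - t ^ (i.val + 1))⁻¹ := by
  have h1 := tsum_subtype {g : Fin d → ℕ | ∀ i, nextVal g i + δ i ≤ g i} fun g => t ^ ∑ i, g i
  simp only [Set.indicator_apply, Set.mem_ofPred_eq] at h1
  rw [← h1, ← tsum_pi_pow t fun i : Fin d => i.val + 1, ← ENNReal.tsum_mul_left]
  refine ((dropEquiv δ).tsum_eq _).symm.trans (tsum_congr fun a => ?_)
  rw [← pow_add, ← Finset.sum_add_distrib]
  congr 1
  refine (sum_sum_Ici _).trans (Finset.sum_congr rfl fun j _ => ?_)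
  ring

theorem strictMono_iff_forall_next {α : Type*} [Preorder α] (g : Fin d → α) :
    StrictMono g ↔ ∀ (i : Fin d) (h : i.val + 1 < d), g i < g ⟨i.val + 1, h⟩ := by
  cases d with
  | zero => exact ⟨fun _ i => i.elim0, fun _ i => i.elim0⟩
  | succ n =>
    rw [Fin.strictMono_iff_lt_succ]
    exact ⟨fun H i h => H ⟨i.val, by omega⟩, fun H i => H i.castSucc (by simp)⟩

/-- The indicator of the descents of `σ`. -/
def descent (σ : Equiv.Perm (Fin d)) (i : Fin d) : ℕ :=
  if h : i.val + 1 < d then (if σ ⟨i.val + 1, h⟩ < σ i then 1 else 0) else 0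

theorem maj_eq_sum_descent (σ : Equiv.Perm (Fin d)) :
    maj σ = ∑ i : Fin d, (i.val + 1) * descent σ i := by
  refine Finset.sum_congr rfl fun i _ => ?_
  rw [descent]
  split_ifs <;> simp

end Sequences

/-! ### P-partitions of a naturally labeled poset -/

section PPartitions

variable {V : Type*} {d : ℕ}

/-- `f`, listed along `e`, weakly decreases, and strictly so at the descents of `e`. -/
def IsSortedAlong {P : PartialOrder V} (ω e : LinExt P d) (f : V → ℕ) : Prop :=
  ∀ i, nextVal (f ∘ e.1.symm) i + descent (ω.perm e) i ≤ f (e.1.symm i)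

/-- The key by which a natural labeling and a function sort the vertices. -/
def sortKey {P : PartialOrder V} (ω : LinExt P d) (f : V → ℕ) (v : V) : ℕᵒᵈ ×ₗ Fin d :=
  toLex (OrderDual.toDual (f v), ω.1 v)

theorem sortKey_lt_iff {P : PartialOrder V} (ω : LinExt P d) (f : V → ℕ) (v w : V) :
    sortKey ω f v < sortKey ω f w ↔ f w < f v ∨ f v = f w ∧ ω.1 v < ω.1 w := by
  simp [sortKey, Prod.Lex.toLex_lt_toLex]

theorem sortKey_injective {P : PartialOrder V} (ω : LinExt P d) (f : V → ℕ) :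
    Function.Injective (sortKey ω f) := by
  intro v w h
  simp only [sortKey, EmbeddingLike.apply_eq_iff_eq, Prod.mk.injEq] at h
  exact h.2

/-- Equal consecutive values of f are allowed exactly where the label increases, so being sorted
means listing V by decreasing f with ties broken by increasing label. At the last position the
condition is vacuous. -/
theorem isSortedAlong_iff {P : PartialOrder V} (ω e : LinExt P d) (f : V → ℕ) :
    IsSortedAlong ω e f ↔ StrictMono (sortKey ω f ∘ e.1.symm) := by
  rw [strictMono_iff_forall_next, IsSortedAlong]
  refine forall_congr' fun i => ?_
  by_cases h : i.val + 1 < d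
  · have hne : ω.1 (e.1.symm i) ≠ ω.1 (e.1.symm ⟨i.val + 1, h⟩) := by
      intro h'
      have := congrArg Fin.val (e.1.symm.injective (ω.1.injective h'))
      simp at this
    simp only [nextVal, descent, h, dif_pos, Function.comp_apply, sortKey_lt_iff, forall_true_left,
      LinExt.perm, Equiv.trans_apply]
    by_cases h' : ω.1 (e.1.symm ⟨i.val + 1, h⟩) < ω.1 (e.1.symm i)
    · have := h'.asymm
      simp only [h', if_true, this, and_false, or_false]
      omega
    · have := lt_of_le_of_ne (not_lt.1 h') hne
      simp only [h', if_false, this, and_true]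
      omega
  · simp [nextVal, descent, h]

theorem IsSortedAlong.antitone {P : PartialOrder V} {ω e : LinExt P d} {f : V → ℕ}
    (h : IsSortedAlong ω e f) (v w : V) (hvw : P.le v w) : f w ≤ f v := by
  have h1 := ((isSortedAlong_iff ω e f).1 h).monotone (e.2 v w hvw)
  simp only [Function.comp_apply, Equiv.symm_apply_apply] at h1
  rcases h1.lt_or_eq with h1 | h1
  · rw [sortKey_lt_iff] at h1
    omega
  · rw [sortKey_injective ω f h1]

/-- Two strictly increasing enumerations of the same set of keys coincide. -/
theorem IsSortedAlong.unique {P : PartialOrder V} {ω e e' : LinExt P d} {f : V → ℕ}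
    (h : IsSortedAlong ω e f) (h' : IsSortedAlong ω e' f) : e = e' := by
  have h1 := (isSortedAlong_iff ω e f).1 h
  have h2 := (isSortedAlong_iff ω e' f).1 h'
  have h3 := (h1.range_inj h2).1 (by simp [Set.range_comp])
  apply Subtype.ext
  rw [← Equiv.symm_symm e.1, ← Equiv.symm_symm e'.1]
  congr 1
  ext i
  exact sortKey_injective ω f (congrFun h3 i)

theorem exists_equiv_strictMono {α : Type*} [LinearOrder α] [Fintype V]
    (hd : Fintype.card V = d) (κ : V → α) (hκ : Function.Injective κ) :
    ∃ e : V ≃ Fin d, StrictMono (κ ∘ e.symm) := by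
  let _ : LinearOrder V := LinearOrder.lift' κ hκ
  exact ⟨(Fintype.orderIsoFinOfCardEq V hd).symm.toEquiv,
    fun i j hij => (Fintype.orderIsoFinOfCardEq V hd).strictMono hij⟩

/-- Sorting by the key works: as f reverses the order and ω is natural, the key respects P, so the
sorted list is a linear extension. -/
theorem exists_isSortedAlong [Fintype V] {P : PartialOrder V} (hd : Fintype.card V = d)
    (ω : LinExt P d) (f : V → ℕ) (hf : ∀ v w, P.le v w → f w ≤ f v) :
    ∃ e : LinExt P d, IsSortedAlong ω e f := by
  obtain ⟨e, he⟩ := exists_equiv_strictMono hd (sortKey ω f) (sortKey_injective ω f)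
  refine ⟨⟨e, fun v w hvw => ?_⟩, (isSortedAlong_iff _ _ _).2 he⟩
  by_contra hlt
  have h := he (not_le.1 hlt)
  simp only [Function.comp_apply, Equiv.symm_apply_apply, sortKey_lt_iff] at h
  have h1 := hf v w hvw
  have h2 := ω.2 v w hvw
  omega

open Classical in
/-- The generating function of the order-reversing maps `V → ℕ` of a poset. -/
theorem tsum_orderReversing [Fintype V] (P : PartialOrder V) (hd : Fintype.card V = d)
    (ω : LinExt P d) (t : ℝ≥0∞) :
    ∑' f : V → ℕ, (if ∀ v w, P.le v w → f w ≤ f v then t ^ ∑ v, f v else 0) =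
      (∑ e : LinExt P d, t ^ maj (ω.perm e)) * ∏ i : Fin d, (1 - t ^ (i.val + 1))⁻¹ := by
  -- The order-reversing maps are partitioned by the linear extension along which they are sorted.
  have h1 : ∀ f : V → ℕ, (if ∀ v w, P.le v w → f w ≤ f v then t ^ ∑ v, f v else 0) =
      ∑ e : LinExt P d, if IsSortedAlong ω e f then t ^ ∑ v, f v else 0 := by
    intro f
    split_ifs with hf
    · obtain ⟨e, he⟩ := exists_isSortedAlong hd ω f hf
      rw [Finset.sum_eq_single e (fun e' _ hne => if_neg fun h => hne (h.unique he)) (by simp),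
        if_pos he]
    · exact (Finset.sum_eq_zero fun e _ => if_neg fun h => hf h.antitone).symm
  simp_rw [h1]
  rw [Summable.tsum_finsetSum fun _ _ => ENNReal.summable, Finset.sum_mul]
  refine Finset.sum_congr rfl fun e _ => ?_
  rw [maj_eq_sum_descent, ← tsum_drop,
    ← (Equiv.arrowCongr e.1.symm (Equiv.refl ℕ)).tsum_eq]
  refine tsum_congr fun g => ?_
  have h2 : ∑ v, (Equiv.arrowCongr e.1.symm (Equiv.refl ℕ)) g v = ∑ i, g i := by
    rw [← e.1.symm.sum_comp]
    simp [Equiv.arrowCongr]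
  rw [h2]
  refine if_congr ?_ rfl rfl
  refine forall_congr' fun i => ?_
  have h3 : (Equiv.arrowCongr e.1.symm (Equiv.refl ℕ)) g ∘ e.1.symm = g := by
    ext j
    simp [Equiv.arrowCongr]
  rw [h3, ← Function.comp_apply (f := (Equiv.arrowCongr e.1.symm (Equiv.refl ℕ)) g), h3]

end PPartitions

/-! ### Orientations of a forest and edges of constancy -/

section Orientations

variable {V : Type*}

/-- Every orientation of a forest is acyclic. -/
theorem not_transGen_of_isAcyclic {G : SimpleGraph V} (hG : G.IsAcyclic) {r : V → V → Prop}
    (hr : ∀ v w, r v w → G.Adj v w) (hasymm : ∀ v w, ¬ (r v w ∧ r w v)) (v : V) :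
    ¬ Relation.TransGen r v v := by
  intro h
  obtain ⟨w, hvw, hwv⟩ := Relation.TransGen.head'_iff.1 h
  have hb := SimpleGraph.isAcyclic_iff_forall_adj_isBridge.1 hG (hr v w hvw)
  rw [SimpleGraph.isBridge_iff] at hb
  -- A directed path from w can avoid the edge vw: crossing it from v to w only returns to w, and
  -- asymmetry forbids the other direction. A directed cycle through this edge would then contradict
  -- its being a bridge.
  have key : ∀ x, Relation.ReflTransGen r w x → (G.deleteEdges {s(v, w)}).Reachable w x := by
    intro x hx
    induction hx with
    | refl => rfl
    | @tail x y _ hxy ih =>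
      by_cases he : s(x, y) = s(v, w)
      · rcases Sym2.eq_iff.1 he with ⟨rfl, rfl⟩ | ⟨rfl, rfl⟩
        · rfl
        · exact absurd ⟨hxy, hvw⟩ (hasymm _ _)
      · refine ih.trans (SimpleGraph.Adj.reachable ?_)
        rw [SimpleGraph.deleteEdges_adj]
        exact ⟨hr _ _ hxy, he⟩
  exact hb (key v hwv).symm

theorem AcyclicOrientation.forall_le_iff {G : SimpleGraph V} (ρ : AcyclicOrientation G)
    (f : V → ℕ) :
    (∀ v w, ρ.poset.le v w → f w ≤ f v) ↔ ∀ v w, ρ.rel v w → f w ≤ f v := by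
  refine ⟨fun h v w hvw => h v w (.single hvw), fun h v w hvw => ?_⟩
  induction hvw with
  | refl => rfl
  | tail _ h1 ih => exact (h _ _ h1).trans ih

/-- The orientation of a forest that decreases `f` and, on an edge where `f` is constant, follows
a fixed linear order exactly when the edge lies in `S`. -/
def orientationOfFinset [LinearOrder V] {G : SimpleGraph V} (hG : G.IsAcyclic) (f : V → ℕ)
    (S : Finset (Sym2 V)) : AcyclicOrientation G where
  rel v w := G.Adj v w ∧ (f w < f v ∨ f v = f w ∧ (v < w ↔ s(v, w) ∈ S))
  adj_of_rel _ _ h := h.1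
  rel_or_rel v w h := by
    have := h.ne
    have h2 := h.symm
    have h3 : s(w, v) = s(v, w) := Sym2.eq_swap
    rw [h3]
    grind
  not_rel_and_rel v w h := by
    have := h.1.1.ne
    have h3 : s(w, v) = s(v, w) := Sym2.eq_swap
    rw [h3] at h
    grind
  acyclic := by
    refine not_transGen_of_isAcyclic hG (fun _ _ h => h.1) fun v w h => ?_
    have := h.1.1.ne
    have h3 : s(w, v) = s(v, w) := Sym2.eq_swap
    rw [h3] at h
    grind

open Classical in
/-- The orientations of a forest that weakly decrease `f` correspond to
the sets of edges on which `f` is constant. -/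
theorem card_orientations [Finite V] {G : SimpleGraph V} (hG : G.IsAcyclic)
    {E : Finset (Sym2 V)} (hE : ∀ e, e ∈ E ↔ e ∈ G.edgeSet) (f : V → ℕ) :
    (E.powerset.filter fun S => ∀ e ∈ S, (e.map f).IsDiag).card =
      (Finset.univ.filter fun ρ : AcyclicOrientation G =>
        ∀ v w, ρ.poset.le v w → f w ≤ f v).card := by
  -- An arbitrary order of V supplies a reference direction for every edge.
  let _ : LinearOrder V := LinearOrder.lift' _ (Finite.equivFin V).injective
  refine Finset.card_bij (fun S _ => orientationOfFinset hG f S) ?_ ?_ ?_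
  · intro S _
    rw [Finset.mem_filter, AcyclicOrientation.forall_le_iff]
    refine ⟨Finset.mem_univ _, fun v w h => ?_⟩
    rcases h.2 with h | h
    · exact h.le
    · exact h.1.ge
  -- Injectivity: on an edge where f is constant, the orientation goes upward exactly when the edge
  -- lies in S, so it determines S.
  · have key : ∀ S : Finset (Sym2 V), (S ⊆ E ∧ ∀ e ∈ S, (e.map f).IsDiag) →
        ∀ S' : Finset (Sym2 V),
          orientationOfFinset hG f S = orientationOfFinset hG f S' → S ⊆ S' := by
      intro S hS S' h e he
      have h1 := hS.1 he
      have h2 := hS.2 e he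
      induction e using Sym2.ind with | _ v w
      wlog hvw : v < w generalizing v w
      · rw [Sym2.eq_swap] at he h1 h2 ⊢
        rw [hE, SimpleGraph.mem_edgeSet] at h1
        exact this w v he ((hE _).2 h1) h2 (lt_of_le_of_ne (not_lt.1 hvw) h1.ne)
      rw [hE, SimpleGraph.mem_edgeSet] at h1
      rw [Sym2.map_mk, Sym2.mk_isDiag_iff] at h2
      have h3 : (orientationOfFinset hG f S).rel v w := ⟨h1, Or.inr ⟨h2, by simp [hvw, he]⟩⟩
      rw [h] at h3
      rcases h3.2 with h4 | h4
      · omega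
      · exact h4.2.1 hvw
    intro S hS S' hS' h
    rw [Finset.mem_filter, Finset.mem_powerset] at hS hS'
    exact (key S hS S' h).antisymm (key S' hS' S h.symm)
  · intro ρ hρ
    rw [Finset.mem_filter, AcyclicOrientation.forall_le_iff] at hρ
    -- The preimage consists of the edges of constancy that ρ directs upward.
    refine ⟨E.filter fun e => (e.map f).IsDiag ∧
      ∃ v w, e = s(v, w) ∧ v < w ∧ ρ.rel v w, ?_, ?_⟩
    · rw [Finset.mem_filter, Finset.mem_powerset]
      exact ⟨Finset.filter_subset _ _, fun e he => (Finset.mem_filter.1 he).2.1⟩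
    · apply AcyclicOrientation.ext
      ext v w
      have hmem : ∀ v w, v < w → (s(v, w) ∈ (E.filter fun e => (e.map f).IsDiag ∧
          ∃ v w, e = s(v, w) ∧ v < w ∧ ρ.rel v w) ↔ f v = f w ∧ ρ.rel v w) := by
        intro v w hvw
        rw [Finset.mem_filter, Sym2.map_mk, Sym2.mk_isDiag_iff]
        constructor
        · rintro ⟨_, h1, v', w', h2, h3, h4⟩
          rcases Sym2.eq_iff.1 h2 with ⟨rfl, rfl⟩ | ⟨rfl, rfl⟩
          · exact ⟨h1, h4⟩
          · exact absurd hvw h3.asymm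
        · rintro ⟨h1, h2⟩
          exact ⟨(hE _).2 (ρ.adj_of_rel _ _ h2), h1, v, w, rfl, hvw, h2⟩
      change (G.Adj v w ∧ (f w < f v ∨ f v = f w ∧ (v < w ↔ s(v, w) ∈ _))) ↔ ρ.rel v w
      have a1 := ρ.adj_of_rel v w
      have a2 := ρ.rel_or_rel v w
      have a3 := ρ.not_rel_and_rel v w
      have b1 := hρ.2 v w
      have b2 := hρ.2 w v
      by_cases hadj : G.Adj v w
      · rcases lt_or_gt_of_ne hadj.ne with h | h
        · rw [hmem v w h]
          grind
        · rw [Sym2.eq_swap, hmem w v h]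
          have := h.asymm
          grind
      · exact ⟨fun h => absurd h.1 hadj, fun h => absurd (a1 h) hadj⟩

end Orientations

/-! ### Double counting and return to ℚ(q) -/

open scoped ENNReal

section

variable {V : Type*} [Fintype V]

open Classical in
theorem tsum_const_on_edges (S : Finset (Sym2 V)) (t : ℝ≥0∞) :
    ∑' f : V → ℕ, (if ∀ e ∈ S, (e.map f).IsDiag then t ^ ∑ v, f v else 0) =
      ∏ A ∈ componentSets S, (1 - t ^ A.card)⁻¹ := by
  rw [prod_componentSets S fun m => (1 - t ^ m)⁻¹, ← tsum_pi_pow]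
  simp_rw [← const_on_fromEdgeSet_iff]
  have h := tsum_subtype {f : V → ℕ | ∀ v w,
    (SimpleGraph.fromEdgeSet (S : Set (Sym2 V))).Adj v w → f v = f w} fun f => t ^ ∑ v, f v
  simp only [Set.indicator_apply, Set.mem_ofPred_eq] at h
  rw [← h]
  refine ((constEquiv _).tsum_eq _).symm.trans (tsum_congr fun g => ?_)
  rw [← sum_connectedComponentMk]
  rfl

/-- Both sides enumerate the pairs of an acyclic orientation and a function weakly decreasing
along it. -/
theorem sum_componentSets_eq_sum_orientations [DecidableEq V] {T : SimpleGraph V}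
    [DecidableRel T.Adj] (hT : T.IsAcyclic) {d : ℕ} (hd : Fintype.card V = d)
    (ω : (ρ : AcyclicOrientation T) → LinExt ρ.poset d) (t : ℝ≥0∞) :
    ∑ S ∈ T.edgeFinset.powerset, ∏ A ∈ componentSets S, (1 - t ^ A.card)⁻¹ =
      (∑ ρ : AcyclicOrientation T, ∑ e : LinExt ρ.poset d, t ^ maj ((ω ρ).perm e)) *
        ∏ i : Fin d, (1 - t ^ (i.val + 1))⁻¹ := by
  classical
  rw [Finset.sum_congr rfl fun S _ => (tsum_const_on_edges S t).symm, Finset.sum_mul,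
    Finset.sum_congr rfl fun ρ _ => (tsum_orderReversing _ hd (ω ρ) t).symm,
    ← Summable.tsum_finsetSum fun _ _ => ENNReal.summable,
    ← Summable.tsum_finsetSum fun _ _ => ENNReal.summable]
  -- For each f the two sides are the same power of t, multiplied by the two cardinalities compared
  -- in `card_orientations`.
  refine tsum_congr fun f => ?_
  rw [← Finset.sum_filter]
  trans (T.edgeFinset.powerset.filter fun S => ∀ e ∈ S, (e.map f).IsDiag).card • t ^ ∑ v, f v
  · rw [← Finset.sum_const, Finset.sum_filter]
    exact Finset.sum_congr rfl fun S _ => by congr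
  · rw [Finset.sum_const]
    congr 1
    convert card_orientations hT (E := T.edgeFinset) (by simp) f

theorem toReal_inv_one_sub_pow {t : ℝ} (h0 : 0 < t) (h1 : t < 1) (m : ℕ) :
    ((1 - ENNReal.ofReal t ^ m)⁻¹).toReal = 1 / (1 - t ^ m) := by
  rw [← ENNReal.ofReal_pow h0.le, ← ENNReal.ofReal_one, ← ENNReal.ofReal_sub _ (by positivity),
    ENNReal.toReal_inv, ENNReal.toReal_ofReal (sub_nonneg.2 (pow_le_one₀ h0.le h1.le)), one_div]

theorem sum_componentSets_eq_sum_orientations_real [DecidableEq V] {T : SimpleGraph V}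
    [DecidableRel T.Adj] (hT : T.IsAcyclic) {d : ℕ} (hd : Fintype.card V = d)
    (ω : (ρ : AcyclicOrientation T) → LinExt ρ.poset d) {t : ℝ} (h0 : 0 < t) (h1 : t < 1) :
    ∑ S ∈ T.edgeFinset.powerset, ∏ A ∈ componentSets S, 1 / (1 - t ^ A.card) =
      (∑ ρ : AcyclicOrientation T, ∑ e : LinExt ρ.poset d, t ^ maj ((ω ρ).perm e)) *
        ∏ i : Fin d, 1 / (1 - t ^ (i.val + 1)) := by
  have h := congrArg ENNReal.toReal
    (sum_componentSets_eq_sum_orientations hT hd ω (ENNReal.ofReal t))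
  rw [ENNReal.toReal_mul, ENNReal.toReal_prod, ENNReal.toReal_sum, ENNReal.toReal_sum] at h
  · simp_rw [ENNReal.toReal_prod, toReal_inv_one_sub_pow h0 h1] at h
    rw [h]
    congr 1
    refine Finset.sum_congr rfl fun ρ _ => ?_
    rw [ENNReal.toReal_sum fun _ _ => ENNReal.pow_ne_top ENNReal.ofReal_ne_top]
    simp [ENNReal.toReal_ofReal h0.le]
  · exact fun ρ _ => ENNReal.sum_ne_top.2 fun _ _ => ENNReal.pow_ne_top ENNReal.ofReal_ne_top
  -- Finiteness of the component products uses t < 1 and that components are nonempty.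
  · refine fun S _ => ENNReal.prod_ne_top fun A hA => ENNReal.inv_ne_top.2 ?_
    refine (tsub_pos_of_lt ?_).ne'
    exact pow_lt_one₀ zero_le (by simpa using h1) (componentSets_card_pos hA).ne'

theorem qFact_eq (d : ℕ) : qFact d = ∏ i : Fin d, (1 - q ^ (i.val + 1)) / (1 - q) := by
  rw [Fin.prod_univ_eq_prod_range (fun i => (1 - q ^ (i + 1)) / (1 - q)) d, qFact,
    Finset.range_eq_Ico, Finset.prod_Ico_add' (fun i => (1 - q ^ i) / (1 - q)) 0 d 1]
  rfl

/-- A single real value suffices: a ring homomorphism out of the field ℚ(q) is injective, so the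
identity at `φ q` is the identity in q. The powers of 1 - q then turn the product of the 1 - q^i
into the q-factorial. -/
theorem leadSum_eq [DecidableEq V] {T : SimpleGraph V} [DecidableRel T.Adj] (hT : T.IsAcyclic)
    {d : ℕ} (hd : Fintype.card V = d) (ω : (ρ : AcyclicOrientation T) → LinExt ρ.poset d) :
    (q - q ^ 2) ^ d * leadSum T =
      1 / qFact d * ∑ ρ : AcyclicOrientation T, ∑ e : LinExt ρ.poset d,
        q ^ (d + maj ((ω ρ).perm e)) := by
  obtain ⟨φ, h0, h1⟩ := exists_ringHom_real
  have h : leadSum T = (∑ ρ : AcyclicOrientation T, ∑ e : LinExt ρ.poset d,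
      q ^ maj ((ω ρ).perm e)) * ∏ i : Fin d, 1 / (1 - q ^ (i.val + 1)) := by
    apply φ.injective
    simp only [leadSum, map_mul, map_sum, map_prod, map_div₀, map_one, map_sub, map_pow]
    exact sum_componentSets_eq_sum_orientations_real hT hd ω h0 h1
  simp_rw [pow_add q d, ← Finset.mul_sum]
  rw [h, qFact_eq, Finset.prod_div_distrib, Finset.prod_div_distrib, Finset.prod_const_one,
    Finset.prod_const, Finset.card_univ, Fintype.card_fin, show q - q ^ 2 = q * (1 - q) by ring,
    mul_pow, one_div_div]
  ring

end

end QChromatic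

theorem mainTheorem9 {V : Type*} [Fintype V] [DecidableEq V]
    (T : SimpleGraph V) [DecidableRel T.Adj] (hT : T.IsTree)
    (d : ℕ) (hd : Fintype.card V = d) :
    (∃! p : Polynomial QChromatic.Qq,
        QChromatic.IsQChromaticPolynomial T (fun _ => 1) p) ∧
      ∀ p : Polynomial QChromatic.Qq,
        QChromatic.IsQChromaticPolynomial T (fun _ => 1) p →
          p.leadingCoeff =
              (QChromatic.q - QChromatic.q ^ 2) ^ d *
                ∑ S ∈ T.edgeFinset.powerset,
                  ∏ C ∈ QChromatic.componentSets S, 1 / (1 - QChromatic.q ^ C.card) ∧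
            ∀ ω : (ρ : QChromatic.AcyclicOrientation T) →
                QChromatic.LinExt ρ.poset d,
              p.leadingCoeff =
                1 / QChromatic.qFact d *
                  ∑ ρ : QChromatic.AcyclicOrientation T,
                    ∑ σ : QChromatic.LinExt ρ.poset d,
                      QChromatic.q ^ (d + QChromatic.maj ((ω ρ).perm σ)) := by
  have hp := QChromatic.isQChromaticPolynomial_iff T
  refine ⟨⟨_, (hp _).2 rfl, fun p h => (hp p).1 h⟩, fun p h => ?_⟩
  have hlead : p.leadingCoeff = (QChromatic.q - QChromatic.q ^ 2) ^ d * QChromatic.leadSum T := by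
    rw [(hp p).1 h, QChromatic.leadingCoeff_qChromaticPoly hT, hd]
  exact ⟨hlead, fun ω => hlead.trans (QChromatic.leadSum_eq hT.isAcyclic hd ω)⟩
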